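/- Let $n\ge 1$, let $X$ be a domain (nonempty connected open set) in $\mathbb C^n$, let $z\in X$, and let $Y=\mathbb P^n\times X$. For $\xi=[\xi_0,\dots,\xi_n]\in\mathbb P^n$ and $x\in\mathbb C^n$ write $\xi\cdot x=\xi_0+\xi_1x_1+\dots+\xi_nx_n$, and let $$P_z=\{(\xi,x)\in Y:\xi\cdot z=0\},\qquad Q=\{(\xi,x)\in Y:\xi\cdot x=0\},$$ $$\Phi_z=\frac{\omega'(\xi)\wedge dx_1\wedge\dots\wedge dx_n}{(\xi\cdot z)^n},\qquad \omega'(\xi)=\sum_{k=1}^n(-1)^{k-1}\xi_k\,d\xi_1\wedge\dots\wedge\widehat{d\xi_k}\wedge\dots\wedge d\xi_n,$$ so that $\Phi_z$ is a holomorphic $(2n-1)$-form on $Y\setminus P_z$. Let $S$ be a smooth complex hypersurface in $Y$ such that $P_z$, $Q$ and $S$ are in general position, i.e. at each point of $Y$ the differentials of local defining functions of those of the three hypersurfaces that pass through the point are linearly independent. Suppose that $S$ contains a fibre of the projection $P_z\to X$, i.e. $\{\xi\in\mathbb P^n:\xi\cdot z=0\}\times\{x_0\}\subset S$ for some $x_0\in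 X$, and that the restriction (pullback) of $\Phi_z$ to $S\setminus P_z$ is zero. Then $S$ is the preimage of a smooth hypersurface in $X$: there is a smooth complex hypersurface $S_0$ in $X$ such that $S=\mathbb P^n\times S_0$. -/

import Mathlib

open Set Filter Topology
open scoped LinearAlgebra.Projectivization

/-! ### Smooth hypersurfaces in open subsets of a complex normed space -/

namespace CauchyFantappie

section Hypersurface

variable {E : Type*} [NormedAddCommGroup E] [NormedSpace ℂ E]

/-- `s` is a local defining function for `A` at `p`: it is holomorphic near `p`, its differential
at `p` is not zero, and near `p` the set `A` is the zero set of `s`. -/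
structure IsLocalDefiningFunction (A : Set E) (s : E → ℂ) (p : E) : Prop where
  analyticAt : AnalyticAt ℂ s p
  fderiv_ne_zero : fderiv ℂ s p ≠ 0
  eventually_mem_iff : ∀ᶠ q in 𝓝 p, q ∈ A ↔ s q = 0

/-- `A` is a smooth complex hypersurface in the open set `U`: it is a relatively closed subset of
`U` with a local defining function at each of its points. -/
structure IsSmoothHypersurface (U A : Set E) : Prop where
  subset : A ⊆ U
  relativelyClosed : ∃ C : Set E, IsClosed C ∧ A = U ∩ C
  locallyDefined : ∀ p ∈ A, ∃ s : E → ℂ, IsLocalDefiningFunction A s p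

/-- The holomorphic tangent space at `p` of a smooth hypersurface `A`: the vectors killed by the
differentials of the local defining functions of `A` at `p`. (These differentials are nonzero
multiples of each other, so this is the kernel of any one of them.) -/
def tangentSpaceAt (A : Set E) (p : E) : Submodule ℂ E where
  carrier := {v | ∀ s : E → ℂ, IsLocalDefiningFunction A s p → fderiv ℂ s p v = 0}
  add_mem' := by
    intro v w hv hw s hs
    rw [map_add, hv s hs, hw s hs, add_zero]
  zero_mem' := by
    intro s _
    exact map_zero _
  smul_mem' := by
    intro c v hv s hs
    rw [map_smul, hv s hs, smul_zero]

/-- The smooth hypersurfaces `A i` are in general position at `p`: the differentials at `p` of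
local defining functions of those `A i` that pass through `p` are linearly independent. -/
def InGeneralPositionAt {ι : Type*} (A : ι → Set E) (p : E) : Prop :=
  ∀ s : ι → E → ℂ, (∀ i, p ∈ A i → IsLocalDefiningFunction (A i) (s i) p) →
    LinearIndependent ℂ (fun i : {i : ι // p ∈ A i} => fderiv ℂ (s i) p)

/-- The wedge product `θ 0 ∧ ⋯ ∧ θ (m - 1)` of linear forms, which takes `v` to the determinant of
the matrix of the values `θ i (v j)`. -/
noncomputable def wedge {m : ℕ} (θ : Fin m → E →ₗ[ℂ] ℂ) : E [⋀^Fin m]→ₗ[ℂ] ℂ :=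
  (Matrix.detRowAlternating (R := ℂ) (n := Fin m)).compLinearMap (LinearMap.pi θ)

theorem wedge_apply {m : ℕ} (θ : Fin m → E →ₗ[ℂ] ℂ) (v : Fin m → E) :
    wedge θ v = (Matrix.of fun i j => θ i (v j)).det := by
  rw [← Matrix.det_transpose]
  rfl

end Hypersurface

/-! ### The space `Y = ℙⁿ⁺¹ × X` over a domain `X` in `ℂⁿ⁺¹`, in affine charts -/

/-- `ℙⁿ⁺¹ × ℂⁿ⁺¹`, which contains `Y = ℙⁿ⁺¹ × X` for each domain `X` in `ℂⁿ⁺¹`. -/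
abbrev Ambient (n : ℕ) : Type := (ℙ ℂ (Fin (n + 2) → ℂ)) × (Fin (n + 1) → ℂ)

/-- The space of homogeneous coordinates `ξ` and coordinates `x`. -/
abbrev HomogCoord (n : ℕ) : Type := (Fin (n + 2) → ℂ) × (Fin (n + 1) → ℂ)

/-- The space of affine coordinates on `ℙⁿ⁺¹` and coordinates `x`. -/
abbrev AffineCoord (n : ℕ) : Type := (Fin (n + 1) → ℂ) × (Fin (n + 1) → ℂ)

/-- `ξ · x = ξ₀ + ξ₁ x₁ + ⋯`. -/
def pairing {n : ℕ} (ξ : Fin (n + 2) → ℂ) (x : Fin (n + 1) → ℂ) : ℂ :=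
  ξ 0 + ∑ j : Fin (n + 1), ξ j.succ * x j

/-- The hypersurface `Q = {(ξ, x) ∈ Y : ξ · x = 0}`. -/
def hypersurfaceQ {n : ℕ} (X : Set (Fin (n + 1) → ℂ)) : Set (Ambient n) :=
  {p | p.2 ∈ X ∧ pairing p.1.rep p.2 = 0}

/-- The hypersurface `P_z = {(ξ, x) ∈ Y : ξ · z = 0}`. -/
def hypersurfaceP {n : ℕ} (X : Set (Fin (n + 1) → ℂ)) (z : Fin (n + 1) → ℂ) : Set (Ambient n) :=
  {p | p.2 ∈ X ∧ pairing p.1.rep z = 0}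

theorem pairing_smul {n : ℕ} (c : ℂ) (ξ : Fin (n + 2) → ℂ) (x : Fin (n + 1) → ℂ) :
    pairing (c • ξ) x = c * pairing ξ x := by
  simp [pairing, mul_add, Finset.mul_sum, mul_assoc]

theorem pairing_rep_eq_zero_iff {n : ℕ} (ξ : Fin (n + 2) → ℂ) (hξ : ξ ≠ 0)
    (x : Fin (n + 1) → ℂ) :
    pairing (Projectivization.mk ℂ ξ hξ).rep x = 0 ↔ pairing ξ x = 0 := by
  obtain ⟨a, ha⟩ := Projectivization.exists_smul_eq_mk_rep ℂ ξ hξ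
  rw [← ha, Units.smul_def, pairing_smul]
  simp

/-- The section `(y, x) ↦ ((y₀, …, 1, …, yₙ), x)`, with `1` in position `k`, of homogeneous
coordinates over the affine chart `ξ_k ≠ 0`. -/
def affineLift {n : ℕ} (k : Fin (n + 2)) (p : AffineCoord n) : HomogCoord n :=
  (Fin.insertNth (α := fun _ => ℂ) k 1 p.1, p.2)

theorem affineLift_fst_ne_zero {n : ℕ} (k : Fin (n + 2)) (p : AffineCoord n) :
    (affineLift k p).1 ≠ 0 := by
  intro h
  have := congrFun h k
  simp [affineLift] at this

/-- The derivative `(v, w) ↦ ((v₀, …, 0, …, vₙ), w)` of `affineLift k`. -/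
noncomputable def affineLiftDeriv {n : ℕ} (k : Fin (n + 2)) :
    AffineCoord n →L[ℂ] HomogCoord n :=
  LinearMap.toContinuousLinearMap
    { toFun := fun v => (Fin.insertNth (α := fun _ => ℂ) k 0 v.1, v.2)
      map_add' := by
        intro v w
        refine Prod.ext (funext fun j => ?_) rfl
        refine Fin.succAboveCases k ?_ (fun i => ?_) j <;> simp
      map_smul' := by
        intro c v
        refine Prod.ext (funext fun j => ?_) rfl
        refine Fin.succAboveCases k ?_ (fun i => ?_) j <;> simp }

theorem hasFDerivAt_affineLift {n : ℕ} (k : Fin (n + 2)) (p : AffineCoord n) :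
    HasFDerivAt (affineLift k) (affineLiftDeriv k) p := by
  have h : (affineLift k : AffineCoord n → HomogCoord n) =
      fun q => affineLiftDeriv k q + affineLift k 0 := by
    funext q
    refine Prod.ext (funext fun j => ?_) ?_
    · refine Fin.succAboveCases k ?_ (fun i => ?_) j <;> simp [affineLift, affineLiftDeriv]
    · simp [affineLift, affineLiftDeriv]
  rw [h]
  exact (affineLiftDeriv k).hasFDerivAt.add_const _

/-- The inverse of the affine chart of `ℙⁿ⁺¹ × ℂⁿ⁺¹` on the open set where `ξ_k ≠ 0`. -/
noncomputable def affineChart {n : ℕ} (k : Fin (n + 2)) (p : AffineCoord n) : Ambient n :=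
  (Projectivization.mk ℂ (affineLift k p).1 (affineLift_fst_ne_zero k p), p.2)

/-- `S` is a smooth hypersurface in the complex manifold `Y = ℙⁿ⁺¹ × X`: it is one in each of the
affine charts `ℂⁿ⁺¹ × X`, whose domains are an open cover of `Y`. -/
def IsSmoothHypersurfaceInY {n : ℕ} (X : Set (Fin (n + 1) → ℂ)) (S : Set (Ambient n)) : Prop :=
  (∀ p ∈ S, p.2 ∈ X) ∧
    ∀ k : Fin (n + 2), IsSmoothHypersurface ((univ : Set (Fin (n + 1) → ℂ)) ×ˢ X)
      (affineChart k ⁻¹' S)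

/-- The smooth hypersurfaces `A i` in `Y = ℙⁿ⁺¹ × X` are in general position: they are so at each
point of each affine chart `ℂⁿ⁺¹ × X`. -/
def InGeneralPosition {n : ℕ} {ι : Type*} (X : Set (Fin (n + 1) → ℂ))
    (A : ι → Set (Ambient n)) : Prop :=
  ∀ (k : Fin (n + 2)), ∀ p ∈ (univ : Set (Fin (n + 1) → ℂ)) ×ˢ X,
    InGeneralPositionAt (fun i => affineChart k ⁻¹' A i) p

/-! ### The form `Φ_z` -/

/-- The linear form `dξ_k` on the space of homogeneous coordinates. -/
def dxi {n : ℕ} (k : Fin (n + 2)) : HomogCoord n →ₗ[ℂ] ℂ :=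
  LinearMap.proj k ∘ₗ LinearMap.fst ℂ (Fin (n + 2) → ℂ) (Fin (n + 1) → ℂ)

/-- The linear form `dx_k`, with `k` counted from `0`. -/
def dx {n : ℕ} (k : Fin (n + 1)) : HomogCoord n →ₗ[ℂ] ℂ :=
  LinearMap.proj k ∘ₗ LinearMap.snd ℂ (Fin (n + 2) → ℂ) (Fin (n + 1) → ℂ)

/-- The form `Φ_z = ω'(ξ) ∧ ω(x) / (ξ · z)ⁿ⁺¹` in homogeneous coordinates, where
`ω'(ξ) = ∑_{k ≥ 1} (-1)^(k-1) ξ_k dξ₁ ∧ ⋯ (dξ_k omitted) ⋯ ∧ dξₙ₊₁` and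
`ω(x) = dx₁ ∧ ⋯ ∧ dxₙ₊₁`. Here `k - 1` is the summation index. -/
noncomputable def formPhiHomog {n : ℕ} (z : Fin (n + 1) → ℂ) (p : HomogCoord n) :
    HomogCoord n [⋀^Fin (n + (n + 1))]→ₗ[ℂ] ℂ :=
  ((pairing p.1 z) ^ (n + 1))⁻¹ •
    ∑ k : Fin (n + 1), ((-1 : ℂ) ^ (k : ℕ) * p.1 k.succ) •
      wedge (Fin.append (fun j : Fin n => dxi (k.succAbove j).succ) (fun j : Fin (n + 1) => dx j))

/-- The form `Φ_z` on `Y ∖ P_z` in the affine chart `ξ_k ≠ 0`: the pullback of its expression in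
homogeneous coordinates by the section `affineLift k`. -/
noncomputable def formPhi {n : ℕ} (z : Fin (n + 1) → ℂ) (k : Fin (n + 2)) (p : AffineCoord n) :
    AffineCoord n [⋀^Fin (n + (n + 1))]→ₗ[ℂ] ℂ :=
  (formPhiHomog z (affineLift k p)).compLinearMap
    (affineLiftDeriv k : AffineCoord n →ₗ[ℂ] HomogCoord n)

/-- `Φ_z | S ∖ P_z = 0`: at each point of `S ∖ P_z` the form `Φ_z` is zero on all tuples of
vectors tangent to `S`. -/
def PhiVanishesOn {n : ℕ} (X : Set (Fin (n + 1) → ℂ)) (z : Fin (n + 1) → ℂ)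
    (S : Set (Ambient n)) : Prop :=
  ∀ (k : Fin (n + 2)) (p : AffineCoord n), affineChart k p ∈ S \ hypersurfaceP X z →
    ∀ v : Fin (n + (n + 1)) → AffineCoord n,
      (∀ i, v i ∈ tangentSpaceAt (affineChart k ⁻¹' S) p) → formPhi z k p v = 0

/-- `S` contains a fibre of the projection `P_z → X`. -/
def ContainsFibreOfP {n : ℕ} (X : Set (Fin (n + 1) → ℂ)) (z : Fin (n + 1) → ℂ)
    (S : Set (Ambient n)) : Prop :=
  ∃ x ∈ X, ∀ ξ : ℙ ℂ (Fin (n + 2) → ℂ), (ξ, x) ∈ hypersurfaceP X z → (ξ, x) ∈ S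

end CauchyFantappie

/-! In a chart `ξ_k ≠ 0`, `k ≥ 1`, the form `Φ_z` does not contain `dξ₀`, and it is nonzero off
`P_z`. If `∂/∂ξ₀` were not tangent to `S` at a point off `P_z`, every vector would be a tangent
vector plus a multiple of `∂/∂ξ₀`, and the vanishing of `Φ_z` on `S` would force `Φ_z = 0` there. So
`∂/∂ξ₀` is tangent to `S` off `P_z`. Transversality of `S` and `P_z` extends this by continuity to
all of `S` in these charts. Hence each fibre of `S` over `X` is a cone with vertex `[1, 0, …, 0]`
(`IsRuled`).

Now let `V` be the set of `x` with `([1, 0, …, 0], x) ∈ S`; closedness of `S` makes it the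
projection of `S` to `X`. At a vertex point of `S` the differential of a defining function is
nonzero. If it is nonzero along the fibre, nearby fibres all meet `S`, so `x` is interior to `V`. If
it is nonzero along `X`, then `x` is not interior, and the cone structure forces the whole fibre
over `x` into `S` (`IsRuled.mem_of_fderiv_ne_zero`).

The second condition is open, so the interior of `V` is relatively closed in `X`, and by
connectedness it is empty or `V = X`. The fibre of `P_z` in `S` generates, as a cone, the full fibre
over `x₀`. If `V = X`, the differential at the vertex over `x₀` would vanish both along the fibre
and along `X`, which is absurd. So the interior is empty, `V` is smooth, and every fibre of `S` over
a point of `V` is full. -/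

namespace CauchyFantappie

/-! ### Tangent directions and translation invariance of smooth hypersurfaces -/

section Hypersurface

variable {E : Type*} [NormedAddCommGroup E] [NormedSpace ℂ E]

/-- The zero set of a holomorphic function `s` is, near a zero where the derivative in the
direction `v` does not vanish, met by the lines parallel to `v` in a point that depends
holomorphically on the line. -/
theorem exists_analyticAt_eventually_apply_add_smul_eq_zero [CompleteSpace E] {s : E → ℂ} {p v : E}
    (hs : AnalyticAt ℂ s p) (h0 : s p = 0) (hv : fderiv ℂ s p v ≠ 0) :
    ∃ σ : E → ℂ, AnalyticAt ℂ σ p ∧ σ p = 0 ∧ ∀ᶠ q in 𝓝 p, s (q + σ q • v) = 0 := by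
  let L : E × ℂ →L[ℂ] E :=
    ContinuousLinearMap.fst ℂ E ℂ + (ContinuousLinearMap.snd ℂ E ℂ).smulRight v
  have hL : ∀ w : E × ℂ, L w = w.1 + w.2 • v := fun w => rfl
  have hLp : L (p, 0) = p := by simp [hL]
  have hsL : AnalyticAt ℂ s (L (p, 0)) := by rwa [hLp]
  let f : E × ℂ → ℂ := s ∘ L
  have hf : AnalyticAt ℂ f (p, 0) := hsL.comp (L.analyticAt _)
  have hfd : fderiv ℂ f (p, 0) = (fderiv ℂ s p).comp L := by
    have := (hsL.differentiableAt.hasFDerivAt).comp (p, (0 : ℂ)) L.hasFDerivAt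
    rw [hLp] at this
    exact this.fderiv
  have cdf : ContDiffAt ℂ ⊤ f (p, 0) := hf.contDiffAt
  have hinv : (fderiv ℂ f (p, 0) ∘L .inr ℂ E ℂ).IsInvertible := by
    refine ⟨ContinuousLinearEquiv.smulLeft (Units.mk0 _ hv), ?_⟩
    ext
    simp [hfd, hL, Units.smul_def]
  refine ⟨cdf.implicitFunction (by simp) hinv, (cdf.contDiffAt_implicitFunction _ hinv).analyticAt,
    cdf.implicitFunction_apply_self _ hinv, ?_⟩
  filter_upwards [cdf.eventually_apply_implicitFunction (by simp) hinv] with q hq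
  simpa [f, hL, h0] using hq

theorem IsLocalDefiningFunction.apply_eq_zero {A : Set E} {s : E → ℂ} {p : E}
    (h : IsLocalDefiningFunction A s p) (hp : p ∈ A) : s p = 0 :=
  h.eventually_mem_iff.self_of_nhds.1 hp

theorem IsLocalDefiningFunction.exists_apply_ne_zero {A : Set E} {s : E → ℂ} {p : E}
    (h : IsLocalDefiningFunction A s p) : ∃ v, fderiv ℂ s p v ≠ 0 := by
  by_contra! hv
  exact h.fderiv_ne_zero (ContinuousLinearMap.ext hv)

/-- This is the local projection onto `A` along a transversal direction `v`; curves in `A` and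
nearby points of `A` are obtained from it. -/
theorem IsLocalDefiningFunction.eventually_exists_smul_mem [CompleteSpace E] {A : Set E}
    {s : E → ℂ} {p v : E} (h : IsLocalDefiningFunction A s p) (hp : p ∈ A)
    (hv : fderiv ℂ s p v ≠ 0) :
    ∃ σ : E → ℂ, AnalyticAt ℂ σ p ∧ σ p = 0 ∧
      ∀ᶠ q in 𝓝 p, s (q + σ q • v) = 0 ∧ q + σ q • v ∈ A := by
  obtain ⟨σ, hσ, hσp, hσ0⟩ :=
    exists_analyticAt_eventually_apply_add_smul_eq_zero h.analyticAt (h.apply_eq_zero hp) hv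
  refine ⟨σ, hσ, hσp, ?_⟩
  have ht : Tendsto (fun q => q + σ q • v) (𝓝 p) (𝓝 p) := by
    have : ContinuousAt (fun q => q + σ q • v) p :=
      continuousAt_id.add (hσ.continuousAt.smul continuousAt_const)
    simpa [ContinuousAt, hσp] using this
  filter_upwards [hσ0, ht.eventually h.eventually_mem_iff] with q h1 h2
  exact ⟨h1, h2.2 h1⟩

/-- A vector killed by the differential of a local defining function is the velocity of a
holomorphic curve in the hypersurface. -/
theorem IsLocalDefiningFunction.exists_hasDerivAt [CompleteSpace E] {A : Set E} {s : E → ℂ}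
    {p w : E} (h : IsLocalDefiningFunction A s p) (hp : p ∈ A) (hw : fderiv ℂ s p w = 0) :
    ∃ c : ℂ → E, c 0 = p ∧ HasDerivAt c w 0 ∧ ∀ᶠ t in 𝓝 0, c t ∈ A := by
  obtain ⟨v, hv⟩ := h.exists_apply_ne_zero
  obtain ⟨σ, hσ, hσp, hσ0⟩ := h.eventually_exists_smul_mem hp hv
  have hl : HasDerivAt (fun t : ℂ => p + t • w) w 0 := by
    simpa using ((hasDerivAt_id (0 : ℂ)).smul_const w).const_add p
  have hlp : p + (0 : ℂ) • w = p := by simp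
  have hσl : HasDerivAt (fun t : ℂ => σ (p + t • w)) (fderiv ℂ σ p w) 0 := by
    have := hσ.differentiableAt.hasFDerivAt
    rw [← hlp] at this
    have := this.comp_hasDerivAt (0 : ℂ) hl
    rwa [hlp] at this
  have hc : HasDerivAt (fun t : ℂ => p + t • w + σ (p + t • w) • v)
      (w + fderiv ℂ σ p w • v) 0 := hl.add (hσl.smul_const v)
  have hlt : Tendsto (fun t : ℂ => p + t • w) (𝓝 0) (𝓝 p) := by
    simpa using hl.continuousAt.tendsto
  have hev := hlt.eventually hσ0
  have hc0 : p + (0 : ℂ) • w + σ (p + (0 : ℂ) • w) • v = p := by simp [hσp]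
  have hsc : HasDerivAt (fun t : ℂ => s (p + t • w + σ (p + t • w) • v))
      (fderiv ℂ s p (w + fderiv ℂ σ p w • v)) 0 := by
    have := h.analyticAt.differentiableAt.hasFDerivAt
    rw [← hc0] at this
    have := this.comp_hasDerivAt (0 : ℂ) hc
    rwa [hc0] at this
  -- As `s` vanishes along the corrected line and `ds(w) = 0`, this leaves `dσ(w) ds(v) = 0`: the
  -- correction does not change the velocity.
  have hz : fderiv ℂ s p (w + fderiv ℂ σ p w • v) = 0 :=
    hsc.unique ((hasDerivAt_const (0 : ℂ) (0 : ℂ)).congr_of_eventuallyEq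
      (hev.mono fun t ht => ht.1))
  have hz' : fderiv ℂ σ p w = 0 := by
    simpa [hw, hv] using hz
  exact ⟨_, hc0, by simpa [hz'] using hc, hev.mono fun t ht => ht.2⟩

/-- The tangent space of a hypersurface is the kernel of the differential of any local defining
function. -/
theorem IsLocalDefiningFunction.mem_tangentSpaceAt_iff [CompleteSpace E] {A : Set E} {s : E → ℂ}
    {p w : E} (h : IsLocalDefiningFunction A s p) (hp : p ∈ A) :
    w ∈ tangentSpaceAt A p ↔ fderiv ℂ s p w = 0 := by
  refine ⟨fun hw => hw s h, fun hw r hr => ?_⟩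
  obtain ⟨c, hc0, hc, hcA⟩ := h.exists_hasDerivAt hp hw
  have hrc : HasDerivAt (fun t => r (c t)) (fderiv ℂ r p w) 0 := by
    have := hr.analyticAt.differentiableAt.hasFDerivAt
    rw [← hc0] at this
    have := this.comp_hasDerivAt (0 : ℂ) hc
    rwa [hc0] at this
  have hct : Tendsto c (𝓝 0) (𝓝 p) := by simpa [ContinuousAt, hc0] using hc.continuousAt
  refine hrc.unique ((hasDerivAt_const (0 : ℂ) (0 : ℂ)).congr_of_eventuallyEq ?_)
  filter_upwards [hcA, hct.eventually hr.eventually_mem_iff] with t h1 h2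
  exact h2.1 h1

theorem IsLocalDefiningFunction.eventually_isLocalDefiningFunction {A : Set E}
    {s : E → ℂ} {p : E} (h : IsLocalDefiningFunction A s p) :
    ∀ᶠ q in 𝓝 p, IsLocalDefiningFunction A s q := by
  have hc : ContinuousAt (fderiv ℂ s) p := h.analyticAt.fderiv.continuousAt
  filter_upwards [h.analyticAt.eventually_analyticAt, h.eventually_mem_iff.eventually_nhds,
    hc.eventually_ne h.fderiv_ne_zero] with q h1 h2 h3
  exact ⟨h1, h3, h2⟩

/-- If the differentials of the local defining functions of two hypersurfaces are linearly
independent, a direction that is tangent to the first one off the second one is tangent to the first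
one. -/
theorem IsLocalDefiningFunction.fderiv_apply_eq_zero_of_linearIndependent [CompleteSpace E]
    {A B : Set E} {s r : E → ℂ} {p e : E} (hs : IsLocalDefiningFunction A s p) (hp : p ∈ A)
    (hr : IsLocalDefiningFunction B r p)
    (hli : LinearIndependent ℂ ![fderiv ℂ r p, fderiv ℂ s p])
    (he : ∀ q ∈ A \ B, e ∈ tangentSpaceAt A q) : fderiv ℂ s p e = 0 := by
  obtain ⟨w, hw, hrw⟩ : ∃ w, fderiv ℂ s p w = 0 ∧ fderiv ℂ r p w ≠ 0 := by
    by_contra! H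
    obtain ⟨v, hv⟩ := hs.exists_apply_ne_zero
    rw [LinearIndependent.pair_iff] at hli
    have h1 := (hli (fderiv ℂ s p v) (-fderiv ℂ r p v) ?_).1
    · exact hv h1
    · ext u
      -- This vector is in the kernel of `ds`. Were that kernel inside the kernel of `dr`, then
      -- `ds(v) dr = dr(v) ds` would be a linear relation.
      have := H (fderiv ℂ s p v • u - fderiv ℂ s p u • v) (by simp [mul_comm])
      simp only [map_sub, map_smul, smul_eq_mul] at this
      simp only [_root_.add_apply, _root_.smul_apply, smul_eq_mul,
        _root_.zero_apply]
      linear_combination this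
  obtain ⟨c, hc0, hc, hcA⟩ := hs.exists_hasDerivAt hp hw
  have hct : Tendsto c (𝓝 0) (𝓝 p) := by simpa [ContinuousAt, hc0] using hc.continuousAt
  have hrc : HasDerivAt (fun t => r (c t)) (fderiv ℂ r p w) 0 := by
    have := hr.analyticAt.differentiableAt.hasFDerivAt
    rw [← hc0] at this
    have := this.comp_hasDerivAt (0 : ℂ) hc
    rwa [hc0] at this
  -- The curve in `A` leaves `B` at once because `dr(w) ≠ 0`, so `p` is a limit of points of `A \
  -- B`.
  have hne : ∀ᶠ t in 𝓝[≠] (0 : ℂ), fderiv ℂ s (c t) e = 0 := by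
    filter_upwards [hrc.eventually_ne hrw, nhdsWithin_le_nhds hcA,
      nhdsWithin_le_nhds (hct.eventually hr.eventually_mem_iff),
      nhdsWithin_le_nhds (hct.eventually hs.eventually_isLocalDefiningFunction)] with t h1 h2 h3 h4
    exact he _ ⟨h2, fun h => h1 (h3.1 h)⟩ s h4
  have hlim : Tendsto (fun t => fderiv ℂ s (c t) e) (𝓝[≠] 0) (𝓝 (fderiv ℂ s p e)) := by
    have hcf : ContinuousAt (fun q => fderiv ℂ s q e) p :=
      hs.analyticAt.fderiv.continuousAt.clm_apply continuousAt_const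
    exact (hcf.tendsto.comp hct).mono_left nhdsWithin_le_nhds
  exact tendsto_nhds_unique (hlim.congr' hne) tendsto_const_nhds |>.symm ▸ rfl

/-- A hypersurface to which the direction `e` is tangent everywhere is locally invariant under
translation in the direction `e`. -/
theorem IsLocalDefiningFunction.eventually_add_smul_mem [CompleteSpace E] {A : Set E} {s : E → ℂ}
    {p e : E} (h : IsLocalDefiningFunction A s p) (hp : p ∈ A)
    (he : ∀ q ∈ A, e ∈ tangentSpaceAt A q) : ∀ᶠ t : ℂ in 𝓝 0, p + t • e ∈ A := by
  obtain ⟨v, hv⟩ := h.exists_apply_ne_zero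
  obtain ⟨σ, hσ, hσp, hσ0⟩ := h.eventually_exists_smul_mem hp hv
  have ht : Tendsto (fun q => q + σ q • v) (𝓝 p) (𝓝 p) := by
    have : ContinuousAt (fun q => q + σ q • v) p :=
      continuousAt_id.add (hσ.continuousAt.smul continuousAt_const)
    simpa [ContinuousAt, hσp] using this
  have hcv : ContinuousAt (fun q => fderiv ℂ s q v) p :=
    h.analyticAt.fderiv.continuousAt.clm_apply continuousAt_const
  have hev : ∀ᶠ q in 𝓝 p, DifferentiableAt ℂ σ q ∧ fderiv ℂ σ q e = 0 ∧ q + σ q • v ∈ A := by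
    filter_upwards [hσ.eventually_analyticAt, hσ0.eventually_nhds,
      ht.eventually h.eventually_isLocalDefiningFunction,
      ht.eventually (hcv.eventually_ne hv)] with q h1 h2 h3 h4
    refine ⟨h1.differentiableAt, ?_, h2.self_of_nhds.2⟩
    have hd : HasFDerivAt (fun q => q + σ q • v)
        (ContinuousLinearMap.id ℂ E + (fderiv ℂ σ q).smulRight v) q :=
      (hasFDerivAt_id q).add (h1.differentiableAt.hasFDerivAt.smul_const v)
    have hd2 := (h3.analyticAt.differentiableAt.hasFDerivAt).comp q hd
    -- Differentiating `s (q + σ q • v) = 0` along `e` gives `ds(e) + dσ(e) ds(v) = 0`, whose first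
    -- term is zero by tangency; so `σ` is constant along `e`.
    have hz := hd2.unique ((hasFDerivAt_const (0 : ℂ) q).congr_of_eventuallyEq
      (h2.mono fun t ht => ht.1))
    have hze := congrArg (fun l : E →L[ℂ] ℂ => l e) hz
    have het := he _ h2.self_of_nhds.2 s h3
    simpa [het, h4] using hze
  have hlt : Tendsto (fun t : ℂ => p + t • e) (𝓝 0) (𝓝 p) := by
    have : ContinuousAt (fun t : ℂ => p + t • e) 0 := by fun_prop
    simpa [ContinuousAt] using this
  obtain ⟨ε, hε, hball⟩ := Metric.eventually_nhds_iff_ball.1 (hlt.eventually hev)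
  filter_upwards [Metric.ball_mem_nhds (0 : ℂ) hε] with t htb
  have hg : ∀ τ ∈ Metric.ball (0 : ℂ) ε, HasDerivAt (fun τ : ℂ => σ (p + τ • e)) 0 τ := by
    intro τ hτ
    obtain ⟨h1, h2, -⟩ := hball τ hτ
    have hl : HasDerivAt (fun t : ℂ => p + t • e) e τ := by
      simpa using ((hasDerivAt_id τ).smul_const e).const_add p
    have := h1.hasFDerivAt.comp_hasDerivAt τ hl
    rwa [h2] at this
  have hconst := (convex_ball (0 : ℂ) ε).is_const_of_fderivWithin_eq_zero (𝕜 := ℂ)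
    (f := fun τ : ℂ => σ (p + τ • e))
    (fun τ hτ => (hg τ hτ).differentiableAt.differentiableWithinAt)
    (fun τ hτ => by
      rw [fderivWithin_of_isOpen Metric.isOpen_ball hτ, (hg τ hτ).hasFDerivAt.fderiv]
      ext; simp) htb (Metric.mem_ball_self hε)
  have := (hball t htb).2.2
  simp only [zero_smul, add_zero, hσp] at hconst
  simpa [hconst] using this

/-- In an open set that is invariant under translation in the direction `e`, a hypersurface to which
`e` is tangent everywhere is invariant under translation in the direction `e`. -/
theorem IsSmoothHypersurface.add_smul_mem [CompleteSpace E] {U A : Set E} {p e : E}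
    (h : IsSmoothHypersurface U A) (hU : ∀ q ∈ U, ∀ t : ℂ, q + t • e ∈ U)
    (he : ∀ q ∈ A, e ∈ tangentSpaceAt A q) (hp : p ∈ A) (t : ℂ) : p + t • e ∈ A := by
  let T : Set ℂ := {t | p + t • e ∈ A}
  have hopen : IsOpen T := by
    rw [isOpen_iff_mem_nhds]
    intro a ha
    obtain ⟨s, hs⟩ := h.locallyDefined _ ha
    have hev := hs.eventually_add_smul_mem ha he
    have ht : Tendsto (fun b : ℂ => b - a) (𝓝 a) (𝓝 0) := by
      have : ContinuousAt (fun b : ℂ => b - a) a := by fun_prop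
      simpa [ContinuousAt] using this
    filter_upwards [ht.eventually hev] with b hb
    have : p + a • e + (b - a) • e = p + b • e := by module
    rwa [this] at hb
  have hclosed : IsClosed T := by
    obtain ⟨C, hC, rfl⟩ := h.relativelyClosed
    have : T = (fun t : ℂ => p + t • e) ⁻¹' C := by
      ext t
      exact ⟨fun ht => ht.2, fun ht => ⟨hU p hp.1 t, ht⟩⟩
    rw [this]
    exact hC.preimage (by fun_prop)
  have hT : T = univ := IsClopen.eq_univ ⟨hclosed, hopen⟩ ⟨0, by simpa [T] using hp⟩
  have : t ∈ T := hT ▸ mem_univ t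
  exact this

end Hypersurface

/-! ### The kernel of `Φ_z` and the tangency of `∂/∂ξ₀` -/

section FormPhi

variable {n : ℕ}

/-- The vector `∂/∂ξ₀` in the affine charts `ξ_k ≠ 0`, `k ≥ 1`. -/
def zerothDirection : AffineCoord n := (Pi.single 0 1, 0)

theorem insertNth_succ_single_zero (m : Fin (n + 1)) (c : ℂ) :
    Fin.insertNth (α := fun _ => ℂ) m.succ 0 (Pi.single 0 c : Fin (n + 1) → ℂ) =
      Pi.single 0 c := by
  funext j
  refine Fin.succAboveCases m.succ ?_ (fun i => ?_) j
  · simp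
  · rw [Fin.insertNth_apply_succAbove]
    refine Fin.cases ?_ (fun i => ?_) i
    · simp
    · rw [Fin.succ_succAbove_succ]
      simp

theorem affineLiftDeriv_zerothDirection (m : Fin (n + 1)) :
    affineLiftDeriv m.succ (zerothDirection : AffineCoord n) = (Pi.single 0 1, 0) :=
  Prod.ext (insertNth_succ_single_zero m 1) rfl

theorem affineLift_add (k : Fin (n + 2)) (p v : AffineCoord n) :
    affineLift k (p + v) = affineLift k p + affineLiftDeriv k v := by
  refine Prod.ext (funext fun j => ?_) rfl
  refine Fin.succAboveCases k ?_ (fun i => ?_) j <;> simp [affineLift, affineLiftDeriv]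

theorem alternatingMap_sum_apply {ι κ E : Type*} [AddCommGroup E] [Module ℂ E] (s : Finset κ)
    (f : κ → E [⋀^ι]→ₗ[ℂ] ℂ) (v : ι → E) : (∑ k ∈ s, f k) v = ∑ k ∈ s, f k v := by
  classical
  induction s using Finset.induction_on with
  | empty => simp
  | insert a s ha ih => rw [Finset.sum_insert ha, Finset.sum_insert ha, AlternatingMap.add_apply, ih]

/-- Only `dξ₁, …` and the `dx_j` occur in `Φ_z`, and all of them kill `∂/∂ξ₀`. -/
theorem formPhi_congr {z : Fin (n + 1) → ℂ} {m : Fin (n + 1)} {p : AffineCoord n}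
    {v w : Fin (n + (n + 1)) → AffineCoord n} (c : Fin (n + (n + 1)) → ℂ)
    (h : ∀ i, v i = w i + c i • zerothDirection) :
    formPhi z m.succ p v = formPhi z m.succ p w := by
  have h' : ∀ i, affineLiftDeriv m.succ (v i) =
      affineLiftDeriv m.succ (w i) + c i • (Pi.single 0 1, 0) := fun i => by
    rw [h, map_add, map_smul, affineLiftDeriv_zerothDirection]
  simp only [formPhi, formPhiHomog, AlternatingMap.compLinearMap_apply, AlternatingMap.smul_apply,
    alternatingMap_sum_apply, AlternatingMap.smul_apply, wedge_apply]
  congr 1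
  refine Finset.sum_congr rfl fun k _ => ?_
  congr 3
  ext i j
  refine Fin.addCases (fun i => ?_) (fun i => ?_) i <;> simp [h', dxi, dx]

theorem formPhi_ne_zero {z : Fin (n + 1) → ℂ} {m : Fin (n + 1)} {p : AffineCoord n}
    (hp : pairing (affineLift m.succ p).1 z ≠ 0) : formPhi z m.succ p ≠ 0 := by
  intro H
  -- The frame dual to the covectors of the summand `k = m`.
  let v : Fin (n + (n + 1)) → AffineCoord n :=
    Fin.append (fun j => (Fin.removeNth (α := fun _ => ℂ) m.succ (Pi.single (m.succAbove j).succ 1), 0))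
      (fun j => (0, Pi.single j 1))
  have hl : ∀ j : Fin n, affineLiftDeriv m.succ (v (Fin.castAdd (n + 1) j)) =
      (Pi.single (m.succAbove j).succ 1, 0) := fun j => by
    refine Prod.ext (funext fun i => ?_) (by simp [v, affineLiftDeriv])
    refine Fin.succAboveCases m.succ ?_ (fun i => ?_) i
    · have : m.succ ≠ (m.succAbove j).succ := by simp [Fin.ne_succAbove, Fin.succ_inj]
      simp [v, affineLiftDeriv, this]
    · simp [v, affineLiftDeriv]
  have hr : ∀ j : Fin (n + 1), affineLiftDeriv m.succ (v (Fin.natAdd n j)) =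
      (0, Pi.single j 1) := fun j => by
    refine Prod.ext (funext fun i => ?_) (by simp [v, affineLiftDeriv])
    refine Fin.succAboveCases m.succ ?_ (fun i => ?_) i <;> simp [v, affineLiftDeriv]
  have hne : ∀ (i : Fin n) (j : Fin (n + 1)), Fin.castAdd (n + 1) i ≠ Fin.natAdd n j :=
    fun i j h => by
      have := congrArg Fin.val h
      simp only [Fin.val_castAdd, Fin.val_natAdd] at this
      omega
  have hv : formPhi z m.succ p v = 0 := by rw [H]; rfl
  simp only [formPhi, formPhiHomog, AlternatingMap.compLinearMap_apply, AlternatingMap.smul_apply,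
    alternatingMap_sum_apply, AlternatingMap.smul_apply, wedge_apply] at hv
  -- Every other summand contains the differential of the coordinate normalized to 1, which is zero
  -- in this chart.
  rw [Finset.sum_eq_single m] at hv
  · have h1 : (Matrix.of fun i j => (Fin.append (fun j : Fin n => dxi (m.succAbove j).succ)
        (fun j : Fin (n + 1) => dx j) : Fin (n + (n + 1)) → HomogCoord n →ₗ[ℂ] ℂ) i
          (affineLiftDeriv m.succ (v j))) = 1 := by
      ext i j
      refine Fin.addCases (fun i => ?_) (fun i => ?_) i <;>
        refine Fin.addCases (fun j => ?_) (fun j => ?_) j <;>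
        simp [hl, hr, dxi, dx, Matrix.one_apply, Pi.single_apply, hne, (hne _ _).symm]
    simp only [ContinuousLinearMap.coe_coe, h1] at hv
    simp [affineLift] at hv
    exact hp hv
  · intro k _ hk
    obtain ⟨j, hj⟩ := Fin.exists_succAbove_eq hk.symm
    rw [Matrix.det_eq_zero_of_row_eq_zero (Fin.castAdd (n + 1) j), smul_zero]
    intro i
    simp [dxi, hj, affineLiftDeriv]
  · simp

/-- The direction of the lines through `[1, 0, …, 0]` is tangent to a hypersurface on which `Φ_z`
vanishes, at the points off `P_z`. -/
theorem zerothDirection_mem_tangentSpaceAt {X : Set (Fin (n + 1) → ℂ)} {z : Fin (n + 1) → ℂ}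
    {S : Set (Ambient n)} (hPhi : PhiVanishesOn X z S) {m : Fin (n + 1)} {p : AffineCoord n}
    (hp : p ∈ affineChart m.succ ⁻¹' S \ affineChart m.succ ⁻¹' hypersurfaceP X z)
    (hpX : p.2 ∈ X) : zerothDirection ∈ tangentSpaceAt (affineChart m.succ ⁻¹' S) p := by
  intro s hs
  by_contra he
  refine formPhi_ne_zero (z := z) (m := m) (p := p) ?_ ?_
  · exact fun h => hp.2 ⟨hpX, (pairing_rep_eq_zero_iff _ _ _).2 h⟩
  · ext v
    -- Subtracting these multiples of `∂/∂ξ₀` projects each `v i` to the kernel of `ds`.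
    let c : Fin (n + (n + 1)) → ℂ := fun i =>
      fderiv ℂ s p (v i) / fderiv ℂ s p zerothDirection
    rw [formPhi_congr (w := fun i => v i - c i • zerothDirection) c (fun i => by simp)]
    refine hPhi m.succ p hp _ fun i => ?_
    rw [hs.mem_tangentSpaceAt_iff hp.1]
    simp [c, he]

theorem pairing_add (ξ η : Fin (n + 2) → ℂ) (x : Fin (n + 1) → ℂ) :
    pairing (ξ + η) x = pairing ξ x + pairing η x := by
  simp only [pairing, Pi.add_apply, add_mul, Finset.sum_add_distrib]
  ring

theorem pairing_single_zero (c : ℂ) (x : Fin (n + 1) → ℂ) :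
    pairing (Pi.single 0 c : Fin (n + 2) → ℂ) x = c := by
  simp [pairing]

theorem analyticAt_pairing_affineLift (k : Fin (n + 2)) {f : AffineCoord n → Fin (n + 1) → ℂ}
    {p : AffineCoord n} (hf : AnalyticAt ℂ f p) :
    AnalyticAt ℂ (fun q => pairing (affineLift k q).1 (f q)) p := by
  have hl : AnalyticAt ℂ (affineLift k : AffineCoord n → HomogCoord n) p := by
    have h : (affineLift k : AffineCoord n → HomogCoord n) =
        fun q => affineLift k 0 + affineLiftDeriv k q := by
      funext q
      rw [← affineLift_add, zero_add]
    rw [h]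
    exact analyticAt_const.add ((affineLiftDeriv k).analyticAt _)
  have hj : ∀ j, AnalyticAt ℂ (fun q : AffineCoord n => (affineLift k q).1 j) p := fun j =>
    ((ContinuousLinearMap.proj (R := ℂ) (φ := fun _ : Fin (n + 2) => ℂ) j).comp
      (ContinuousLinearMap.fst ℂ _ (Fin (n + 1) → ℂ))).analyticAt _ |>.comp hl
  have hfj : ∀ j, AnalyticAt ℂ (fun q : AffineCoord n => f q j) p := fun j =>
    ((ContinuousLinearMap.proj (R := ℂ) (φ := fun _ : Fin (n + 1) => ℂ) j).analyticAt _).comp hf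
  unfold pairing
  exact (hj 0).add (Finset.analyticAt_fun_sum _ fun j _ => (hj j.succ).mul (hfj j))

/-- The incidence relation `ξ · f(x) = 0` defines a smooth hypersurface in the affine charts
`ξ_k ≠ 0`, `k ≥ 1`. -/
theorem isLocalDefiningFunction_pairing {X : Set (Fin (n + 1) → ℂ)} (hX : IsOpen X)
    {f : (Fin (n + 1) → ℂ) → Fin (n + 1) → ℂ} (m : Fin (n + 1)) {p : AffineCoord n}
    (hp : p.2 ∈ X) (hf : AnalyticAt ℂ f p.2) :
    IsLocalDefiningFunction
      (affineChart m.succ ⁻¹' {q : Ambient n | q.2 ∈ X ∧ pairing q.1.rep (f q.2) = 0})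
      (fun q => pairing (affineLift m.succ q).1 (f q.2)) p := by
  have han := analyticAt_pairing_affineLift m.succ (hf.comp (analyticAt_snd (p := p)))
  refine ⟨han, fun h => ?_, ?_⟩
  · have hl : HasDerivAt (fun t : ℂ => p + t • zerothDirection) zerothDirection 0 := by
      simpa using ((hasDerivAt_id (0 : ℂ)).smul_const zerothDirection).const_add p
    have hlp : p + (0 : ℂ) • zerothDirection = p := by simp
    have h1 := han.differentiableAt.hasFDerivAt
    rw [← hlp] at h1
    have h1 := h1.comp_hasDerivAt (0 : ℂ) hl
    have h2 : HasDerivAt (fun t : ℂ => pairing (affineLift m.succ p).1 (f p.2) + t) 1 0 :=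
      (hasDerivAt_id (0 : ℂ)).const_add _
    have heq : (fun t : ℂ => pairing (affineLift m.succ p).1 (f p.2) + t) =
        (fun q : AffineCoord n => pairing (affineLift m.succ q).1 ((f ∘ Prod.snd) q)) ∘
          fun t : ℂ => p + t • zerothDirection := by
      funext t
      have : (p + t • zerothDirection).2 = p.2 := by simp [zerothDirection]
      simp only [Function.comp_apply, this, affineLift_add, map_smul,
        affineLiftDeriv_zerothDirection, Prod.fst_add, Prod.smul_fst, pairing_add, pairing_smul,
        pairing_single_zero, mul_one]
    rw [heq] at h2
    have h3 := h1.unique h2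
    rw [hlp] at h3
    have h4 : fderiv ℂ (fun q : AffineCoord n =>
      pairing (affineLift m.succ q).1 ((f ∘ Prod.snd) q)) p = 0 := h
    rw [h4] at h3
    exact zero_ne_one h3
  · have : ∀ᶠ q : AffineCoord n in 𝓝 p, q.2 ∈ X :=
      continuous_snd.continuousAt.eventually (hX.mem_nhds hp)
    filter_upwards [this] with q hq
    simp only [mem_preimage, mem_ofPred_eq, affineChart, pairing_rep_eq_zero_iff, hq, true_and]

/-- The direction of the lines through `[1, 0, …, 0]` is tangent to a hypersurface in general
position with `P_z` and `Q` on which `Φ_z` vanishes. -/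
theorem zerothDirection_mem_tangentSpaceAt_of_inGeneralPosition {X : Set (Fin (n + 1) → ℂ)}
    (hX : IsOpen X) {z : Fin (n + 1) → ℂ} {S : Set (Ambient n)} (hS : IsSmoothHypersurfaceInY X S)
    (hgen : InGeneralPosition X ![hypersurfaceP X z, hypersurfaceQ X, S])
    (hPhi : PhiVanishesOn X z S) {m : Fin (n + 1)} {p : AffineCoord n}
    (hp : p ∈ affineChart m.succ ⁻¹' S) :
    zerothDirection ∈ tangentSpaceAt (affineChart m.succ ⁻¹' S) p := by
  have hSX : ∀ q ∈ affineChart m.succ ⁻¹' S, q.2 ∈ X := fun q hq => hS.1 _ hq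
  by_cases hpP : p ∈ affineChart m.succ ⁻¹' hypersurfaceP X z
  · obtain ⟨s, hs⟩ := (hS.2 m.succ).locallyDefined p hp
    have hP : IsLocalDefiningFunction (affineChart m.succ ⁻¹' hypersurfaceP X z) _ p :=
      isLocalDefiningFunction_pairing hX (f := fun _ => z) m (hSX p hp) analyticAt_const
    have hQ : IsLocalDefiningFunction (affineChart m.succ ⁻¹' hypersurfaceQ X) _ p :=
      isLocalDefiningFunction_pairing hX (f := fun x => x) m (hSX p hp) analyticAt_id
    have hli := hgen m.succ p ⟨mem_univ _, hSX p hp⟩ ![_, _, s] (fun i _ => by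
      fin_cases i
      exacts [hP, hQ, hs])
    have hli2 := hli.comp ![⟨0, hpP⟩, ⟨2, hp⟩] (by
      intro i j hij
      have hij := congrArg Subtype.val hij
      fin_cases i <;> fin_cases j <;> simp at hij ⊢)
    rw [hs.mem_tangentSpaceAt_iff hp]
    refine hs.fderiv_apply_eq_zero_of_linearIndependent hp hP ?_
      fun q hq => zerothDirection_mem_tangentSpaceAt hPhi hq (hSX q hq.1)
    convert hli2 using 1
    funext i
    fin_cases i <;> rfl
  · exact zerothDirection_mem_tangentSpaceAt hPhi ⟨hp, hpP⟩ (hSX p hp)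

end FormPhi

/-! ### Passage to homogeneous coordinates: `S` is ruled -/

section Homogeneous

variable {n : ℕ}

/-- The cone over `S` in homogeneous coordinates. -/
def homogCone (S : Set (Ambient n)) : Set (HomogCoord n) :=
  {p | ∃ h : p.1 ≠ 0, (Projectivization.mk ℂ p.1 h, p.2) ∈ S}

theorem affineLift_mem_homogCone_iff {S : Set (Ambient n)} {k : Fin (n + 2)} {p : AffineCoord n} :
    affineLift k p ∈ homogCone S ↔ p ∈ affineChart k ⁻¹' S :=
  ⟨fun ⟨_, h⟩ => h, fun h => ⟨affineLift_fst_ne_zero k p, h⟩⟩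

theorem smul_mem_homogCone_iff {S : Set (Ambient n)} {c : ℂ} (hc : c ≠ 0) {ξ : Fin (n + 2) → ℂ}
    {x : Fin (n + 1) → ℂ} : (c • ξ, x) ∈ homogCone S ↔ (ξ, x) ∈ homogCone S := by
  have h : ∀ (h1 : ξ ≠ 0) (h2 : c • ξ ≠ 0),
      Projectivization.mk ℂ (c • ξ) h2 = Projectivization.mk ℂ ξ h1 := fun h1 h2 =>
    (Projectivization.mk_eq_mk_iff' ℂ _ _ _ _).2 ⟨c, rfl⟩
  constructor
  · rintro ⟨h2, hS⟩
    have h1 : ξ ≠ 0 := fun h => h2 (by simp [h])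
    exact ⟨h1, by simpa only [h h1 h2] using hS⟩
  · rintro ⟨h1, hS⟩
    have h2 : c • ξ ≠ 0 := smul_ne_zero hc h1
    exact ⟨h2, by simpa only [h h1 h2] using hS⟩

theorem affineLift_removeNth {k : Fin (n + 2)} {ξ : Fin (n + 2) → ℂ} (hk : ξ k = 1)
    (x : Fin (n + 1) → ℂ) : affineLift k (Fin.removeNth (α := fun _ => ℂ) k ξ, x) = (ξ, x) := by
  refine Prod.ext ?_ rfl
  rw [← Fin.insertNth_self_removeNth (α := fun _ => ℂ) k ξ]
  simp [affineLift, hk]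

theorem exists_succ_ne_zero {ξ : Fin (n + 2) → ℂ} (h : ∀ c : ℂ, ξ ≠ Pi.single 0 c) :
    ∃ m : Fin (n + 1), ξ m.succ ≠ 0 := by
  by_contra! H
  refine h (ξ 0) (funext fun j => ?_)
  refine Fin.cases ?_ (fun i => ?_) j <;> simp [H]

/-- The set `S` in `Y` is a union of lines through `[1, 0, …, 0]` in the fibres, except possibly
for this point. -/
def IsRuled (S : Set (Ambient n)) : Prop :=
  ∀ (ξ : Fin (n + 2) → ℂ) (x : Fin (n + 1) → ℂ), (∀ c : ℂ, ξ ≠ Pi.single 0 c) →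
    (ξ, x) ∈ homogCone S → ∀ t : ℂ, (ξ + Pi.single 0 t, x) ∈ homogCone S

theorem isRuled_of_zerothDirection_mem {X : Set (Fin (n + 1) → ℂ)} {S : Set (Ambient n)}
    (hS : IsSmoothHypersurfaceInY X S)
    (he : ∀ (m : Fin (n + 1)), ∀ p ∈ affineChart m.succ ⁻¹' S,
      zerothDirection ∈ tangentSpaceAt (affineChart m.succ ⁻¹' S) p) : IsRuled S := by
  intro ξ x hξ hmem t
  obtain ⟨m, hm⟩ := exists_succ_ne_zero hξ
  rw [← smul_mem_homogCone_iff (inv_ne_zero hm)] at hmem ⊢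
  have h1 : ((ξ m.succ)⁻¹ • ξ) m.succ = 1 := by simp [hm]
  rw [← affineLift_removeNth h1, affineLift_mem_homogCone_iff] at hmem
  -- Normalizing the coordinate `m.succ` to 1 rescales the translation `t` as well.
  have h2 := (hS.2 m.succ).add_smul_mem (fun q hq t => ⟨mem_univ _, by
    simpa [zerothDirection] using hq.2⟩) (he m) hmem ((ξ m.succ)⁻¹ * t)
  rw [← affineLift_mem_homogCone_iff, affineLift_add, map_smul, affineLift_removeNth h1,
    affineLiftDeriv_zerothDirection] at h2
  convert h2 using 1
  refine Prod.ext ?_ (by simp)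
  simp [← Pi.single_smul]

theorem affineLift_zero_eq (y x : Fin (n + 1) → ℂ) :
    affineLift (0 : Fin (n + 2)) (y, x) = (Fin.cons 1 y, x) := by
  simp [affineLift]

/-! ### Fibrewise cones with vertex `[1, 0, …, 0]` -/

section Ruled

variable {X : Set (Fin (n + 1) → ℂ)} {S : Set (Ambient n)}

theorem cons_ne_single {y : Fin (n + 1) → ℂ} (hy : y ≠ 0) (a c : ℂ) :
    (Fin.cons a y : Fin (n + 2) → ℂ) ≠ Pi.single 0 c := by
  intro h
  refine hy (funext fun j => ?_)
  simpa using congrFun h j.succ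

theorem IsRuled.smul_mem_of_ne_zero (hR : IsRuled S) {y x : Fin (n + 1) → ℂ} {t : ℂ} (ht : t ≠ 0)
    (h : (y, x) ∈ affineChart (0 : Fin (n + 2)) ⁻¹' S) :
    (t • y, x) ∈ affineChart (0 : Fin (n + 2)) ⁻¹' S := by
  by_cases hy : y = 0
  · simpa [hy] using h
  rw [← affineLift_mem_homogCone_iff, affineLift_zero_eq] at h ⊢
  -- The translation takes `[1, y]` to `[t⁻¹, y] = [1, t y]`.
  have h1 := hR _ _ (cons_ne_single hy 1) h (t⁻¹ - 1)
  rw [← smul_mem_homogCone_iff ht] at h1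
  convert h1 using 2
  funext j
  refine Fin.cases ?_ (fun i => ?_) j <;> simp [ht]

/-- The new case is `t = 0`, the vertex, which is a limit of the nonzero multiples and so belongs to
the relatively closed set `S`. -/
theorem IsRuled.smul_mem (hR : IsRuled S) (hS : IsSmoothHypersurfaceInY X S)
    {y x : Fin (n + 1) → ℂ} (h : (y, x) ∈ affineChart (0 : Fin (n + 2)) ⁻¹' S) (t : ℂ) :
    (t • y, x) ∈ affineChart (0 : Fin (n + 2)) ⁻¹' S := by
  obtain ⟨C, hC, hSC⟩ := (hS.2 0).relativelyClosed
  have hx : x ∈ X := hS.1 _ h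
  have hT : IsClosed {t : ℂ | (t • y, x) ∈ affineChart (0 : Fin (n + 2)) ⁻¹' S} := by
    have : {t : ℂ | (t • y, x) ∈ affineChart (0 : Fin (n + 2)) ⁻¹' S} =
        (fun t : ℂ => (t • y, x)) ⁻¹' C := by
      ext t
      rw [hSC]
      exact ⟨fun h => h.2, fun h => ⟨⟨mem_univ _, hx⟩, h⟩⟩
    rw [this]
    exact hC.preimage (by fun_prop)
  have hd : Dense ({0}ᶜ : Set ℂ) := dense_compl_singleton 0
  have hsub : ({0}ᶜ : Set ℂ) ⊆ {t : ℂ | (t • y, x) ∈ affineChart (0 : Fin (n + 2)) ⁻¹' S} :=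
    fun t ht => hR.smul_mem_of_ne_zero ht h
  exact hT.closure_subset_iff.2 hsub (hd.closure_eq ▸ mem_univ t)

/-- The points `x` such that `([1, 0, …, 0], x)` is in `S`. -/
def vertexSlice (S : Set (Ambient n)) : Set (Fin (n + 1) → ℂ) :=
  {x | ((0 : Fin (n + 1) → ℂ), x) ∈ affineChart (0 : Fin (n + 2)) ⁻¹' S}

theorem mem_vertexSlice_of_mem (hR : IsRuled S) (hS : IsSmoothHypersurfaceInY X S)
    {ξ : Fin (n + 2) → ℂ} {x : Fin (n + 1) → ℂ} (h : (ξ, x) ∈ homogCone S) :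
    x ∈ vertexSlice S := by
  by_cases hξ : ∀ c : ℂ, ξ ≠ Pi.single 0 c
  · have h1 := hR ξ x hξ h (1 - ξ 0)
    rw [← affineLift_removeNth (k := 0) (by simp), affineLift_mem_homogCone_iff] at h1
    simpa [vertexSlice] using hR.smul_mem hS h1 0
  · push Not at hξ
    obtain ⟨c, rfl⟩ := hξ
    have hc : c ≠ 0 := by
      rintro rfl
      exact h.1 (by simp)
    rw [← smul_mem_homogCone_iff (inv_ne_zero hc), ← affineLift_removeNth (k := 0) (by simp [hc]),
      affineLift_mem_homogCone_iff] at h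
    simpa [vertexSlice] using hR.smul_mem hS h 0

theorem mem_homogCone_of_forall (hR : IsRuled S) {x : Fin (n + 1) → ℂ}
    (h : ∀ y, (y, x) ∈ affineChart (0 : Fin (n + 2)) ⁻¹' S) {ξ : Fin (n + 2) → ℂ} (hξ : ξ ≠ 0) :
    (ξ, x) ∈ homogCone S := by
  have key : ∀ ξ : Fin (n + 2) → ℂ, ξ 0 ≠ 0 → (ξ, x) ∈ homogCone S := fun ξ h0 => by
    rw [← smul_mem_homogCone_iff (inv_ne_zero h0), ← affineLift_removeNth (k := 0) (by simp [h0]),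
      affineLift_mem_homogCone_iff]
    exact h _
  by_cases h0 : ξ 0 = 0
  -- A point at infinity of the chart `ξ₀ ≠ 0` is moved into the chart by translation by 1, and back
  -- by -1.
  · have h1 := hR (ξ + Pi.single 0 1) x (fun c hc => ?_) (key _ (by simp [h0])) (-1)
    · simpa [add_assoc, ← Pi.single_add] using h1
    · refine hξ (funext fun j => ?_)
      refine Fin.cases h0 (fun i => ?_) j
      simpa using congrFun hc i.succ
  · exact key ξ h0

theorem hasFDerivAt_inr_slice {E F : Type*} [NormedAddCommGroup E] [NormedSpace ℂ E]
    [NormedAddCommGroup F] [NormedSpace ℂ F] {s : E × F → ℂ} {y : E} {x : F}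
    (hs : AnalyticAt ℂ s (y, x)) :
    HasFDerivAt (fun x => s (y, x)) ((fderiv ℂ s (y, x)).comp (.inr ℂ E F)) x :=
  hs.differentiableAt.hasFDerivAt.comp x (hasFDerivAt_prodMk_right y x)

/-- If the fibre is transversal to `S` at `([1, 0, …, 0], x)`, then the projection of `S` to `X` is open
there. -/
theorem IsRuled.eventually_mem_vertexSlice (hR : IsRuled S) (hS : IsSmoothHypersurfaceInY X S)
    {x u : Fin (n + 1) → ℂ} {s : AffineCoord n → ℂ}
    (hs : IsLocalDefiningFunction (affineChart (0 : Fin (n + 2)) ⁻¹' S) s (0, x))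
    (hx : x ∈ vertexSlice S) (hu : fderiv ℂ s (0, x) (u, 0) ≠ 0) :
    ∀ᶠ x' in 𝓝 x, x' ∈ vertexSlice S := by
  obtain ⟨σ, -, -, hσ0⟩ := hs.eventually_exists_smul_mem hx hu
  have ht : Tendsto (fun x' : Fin (n + 1) → ℂ => ((0 : Fin (n + 1) → ℂ), x')) (𝓝 x)
      (𝓝 (0, x)) := (Continuous.prodMk_right _).tendsto x
  filter_upwards [ht.eventually hσ0] with x' h
  have h2 := h.2
  rw [Prod.smul_mk, Prod.mk_add_mk, smul_zero, add_zero] at h2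
  simpa [vertexSlice] using hR.smul_mem hS h2 0

/-- If the slice over `[1, 0, …, 0]` is transversal to `S` at `x`, then `S` contains the fibre
over `x`. -/
theorem IsRuled.mem_of_fderiv_ne_zero (hR : IsRuled S) (hS : IsSmoothHypersurfaceInY X S)
    {x w : Fin (n + 1) → ℂ} {s : AffineCoord n → ℂ}
    (hs : IsLocalDefiningFunction (affineChart (0 : Fin (n + 2)) ⁻¹' S) s (0, x))
    (hx : x ∈ vertexSlice S) (hw : fderiv ℂ s (0, x) (0, w) ≠ 0) (y : Fin (n + 1) → ℂ) :
    (y, x) ∈ affineChart (0 : Fin (n + 2)) ⁻¹' S := by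
  obtain ⟨σ, hσ, hσp, hσ0⟩ := hs.eventually_exists_smul_mem hx hw
  have hl : HasDerivAt (fun a : ℂ => ((0 : Fin (n + 1) → ℂ), x + a • w)) (0, w) 0 := by
    have := ((hasDerivAt_id (0 : ℂ)).smul_const w).const_add x
    simpa using (hasDerivAt_const (0 : ℂ) (0 : Fin (n + 1) → ℂ)).prodMk this
  have hlp : ((0 : Fin (n + 1) → ℂ), x + (0 : ℂ) • w) = (0, x) := by simp
  have hsl : HasDerivAt (fun a : ℂ => s (0, x + a • w)) (fderiv ℂ s (0, x) (0, w)) 0 := by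
    have := hs.analyticAt.differentiableAt.hasFDerivAt
    rw [← hlp] at this
    have := this.comp_hasDerivAt (0 : ℂ) hl
    rwa [hlp] at this
  have hlt : Tendsto (fun a : ℂ => ((0 : Fin (n + 1) → ℂ), x + a • w)) (𝓝 0) (𝓝 (0, x)) := by
    simpa [ContinuousAt] using hl.continuousAt
  -- On the line `x + a w`, the point `x` is isolated in the vertex slice.
  have hiso : ∀ᶠ a : ℂ in 𝓝 0,
      ((0 : Fin (n + 1) → ℂ), x + a • w) ∈ affineChart (0 : Fin (n + 2)) ⁻¹' S → a = 0 := by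
    have h1 := hsl.eventually_ne hw (c := 0)
    rw [eventually_nhdsWithin_iff] at h1
    filter_upwards [h1, hlt.eventually hs.eventually_mem_iff] with a h1 h2 h3
    by_contra ha
    exact h1 ha (h2.1 h3)
  have hσt : Tendsto σ (𝓝 (0, x)) (𝓝 0) := hσp ▸ hσ.continuousAt.tendsto
  have hyt : Tendsto (fun t : ℂ => (t • y, x)) (𝓝 0) (𝓝 (0, x)) := by
    have : Continuous (fun t : ℂ => (t • y, x)) := by fun_prop
    simpa using this.tendsto 0
  obtain ⟨t, ⟨h1, h2⟩, ht⟩ := ((((hyt.eventually hσ0).and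
    (hyt.eventually (hσt.eventually hiso))).filter_mono nhdsWithin_le_nhds).and
    (self_mem_nhdsWithin (s := ({0}ᶜ : Set ℂ)))).exists
  have h3 := h1.2
  rw [Prod.smul_mk, Prod.mk_add_mk, smul_zero, add_zero] at h3
  have h4 := hR.smul_mem hS h3 0
  rw [zero_smul] at h4
  -- The vertex over `x + σ w` is in `S`, so isolation gives `σ = 0`: the small point `t y` lies in
  -- the fibre over `x` itself, and scaling by `t⁻¹` reaches `y`.
  rw [h2 h4, zero_smul, add_zero] at h3
  have h5 := hR.smul_mem hS h3 t⁻¹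
  rwa [inv_smul_smul₀ ht] at h5

/-- The points of the slice over `[1, 0, …, 0]` where it is transversal to `S` are those which are
not in its interior. -/
theorem IsRuled.fderiv_comp_inr_ne_zero_iff (hR : IsRuled S) (hS : IsSmoothHypersurfaceInY X S)
    {x : Fin (n + 1) → ℂ} {s : AffineCoord n → ℂ}
    (hs : IsLocalDefiningFunction (affineChart (0 : Fin (n + 2)) ⁻¹' S) s (0, x))
    (hx : x ∈ vertexSlice S) :
    (fderiv ℂ s (0, x)).comp (.inr ℂ _ _) ≠ 0 ↔ x ∉ interior (vertexSlice S) := by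
  constructor
  · intro hne hint
    refine hne ((hasFDerivAt_inr_slice hs.analyticAt).unique
      ((hasFDerivAt_const (0 : ℂ) x).congr_of_eventuallyEq ?_))
    have ht : Tendsto (fun x' : Fin (n + 1) → ℂ => ((0 : Fin (n + 1) → ℂ), x')) (𝓝 x)
      (𝓝 (0, x)) := (Continuous.prodMk_right _).tendsto x
    filter_upwards [mem_interior_iff_mem_nhds.1 hint, ht.eventually hs.eventually_mem_iff]
      with x' h1 h2
    exact h2.1 h1
  · intro hint hz
    obtain ⟨⟨u, w⟩, huw⟩ := hs.exists_apply_ne_zero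
    have hw : fderiv ℂ s (0, x) (0, w) = 0 := by
      simpa using congrArg (fun l : (Fin (n + 1) → ℂ) →L[ℂ] ℂ => l w) hz
    have hu : fderiv ℂ s (0, x) (u, 0) ≠ 0 := by
      intro h
      refine huw ?_
      have : ((u, w) : AffineCoord n) = (u, 0) + (0, w) := by simp
      rw [this, map_add, h, hw, add_zero]
    exact hint (mem_interior_iff_mem_nhds.2 (hR.eventually_mem_vertexSlice hS hs hx hu))

theorem vertexSlice_subset (hS : IsSmoothHypersurfaceInY X S) : vertexSlice S ⊆ X :=
  fun _ hx => hS.1 _ hx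

theorem exists_isClosed_vertexSlice_eq (hS : IsSmoothHypersurfaceInY X S) :
    ∃ C, IsClosed C ∧ vertexSlice S = X ∩ C := by
  obtain ⟨C, hC, hSC⟩ := (hS.2 0).relativelyClosed
  refine ⟨(fun x => (0, x)) ⁻¹' C, hC.preimage (by fun_prop), ?_⟩
  ext x
  simp only [vertexSlice, hSC]
  exact ⟨fun h => ⟨h.1.2, h.2⟩, fun h => ⟨⟨mem_univ _, h.1⟩, h.2⟩⟩

/-- In a ruled smooth hypersurface, the slice over `[1, 0, …, 0]` is nowhere dense unless it is
everything. -/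
theorem IsRuled.interior_vertexSlice (hR : IsRuled S) (hS : IsSmoothHypersurfaceInY X S)
    (hXc : IsConnected X) : interior (vertexSlice S) = ∅ ∨ vertexSlice S = X := by
  rcases (interior (vertexSlice S)).eq_empty_or_nonempty with h | ⟨a, ha⟩
  · exact Or.inl h
  right
  obtain ⟨C, hC, hSC⟩ := exists_isClosed_vertexSlice_eq hS
  have hsub : X ⊆ interior (vertexSlice S) := by
    refine hXc.isPreconnected.subset_of_closure_inter_subset isOpen_interior
      ⟨a, vertexSlice_subset hS (interior_subset ha), ha⟩ ?_
    rintro x ⟨hxcl, hxX⟩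
    have hxS : x ∈ vertexSlice S := by
      rw [hSC]
      refine ⟨hxX, hC.closure_subset_iff.2 ?_ hxcl⟩
      exact interior_subset.trans (hSC ▸ inter_subset_right)
    obtain ⟨s, hs⟩ := (hS.2 0).locallyDefined _ hxS
    by_contra hx
    have hne := (hR.fderiv_comp_inr_ne_zero_iff hS hs hxS).2 hx
    have ht : Tendsto (fun x' : Fin (n + 1) → ℂ => ((0 : Fin (n + 1) → ℂ), x')) (𝓝 x)
      (𝓝 (0, x)) := (Continuous.prodMk_right _).tendsto x
    have hcont : ContinuousAt (fun q => (fderiv ℂ s q).comp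
        (.inr ℂ (Fin (n + 1) → ℂ) (Fin (n + 1) → ℂ))) (0, x) :=
      hs.analyticAt.fderiv.continuousAt.clm_comp continuousAt_const
    -- Transversality persists near `x`, so it holds at some interior point `b` of the slice, where
    -- it is impossible.
    obtain ⟨b, hb, h1, h2⟩ := ((mem_closure_iff_frequently.1 hxcl).and_eventually
      ((ht.eventually hs.eventually_isLocalDefiningFunction).and
        (ht.eventually (hcont.eventually_ne hne)))).exists
    exact (hR.fderiv_comp_inr_ne_zero_iff hS h1 (interior_subset hb)).1 h2 hb
  exact (vertexSlice_subset hS).antisymm (hsub.trans interior_subset)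

/-- A ruled set that contains a fibre of `P_z → X` contains the fibre of `Y → X`. -/
theorem IsRuled.exists_forall_mem (hR : IsRuled S) (hS : IsSmoothHypersurfaceInY X S)
    {z : Fin (n + 1) → ℂ} (hfib : ContainsFibreOfP X z S) :
    ∃ x ∈ X, ∀ y, (y, x) ∈ affineChart (0 : Fin (n + 2)) ⁻¹' S := by
  obtain ⟨x, hx, h⟩ := hfib
  have key : ∀ y ≠ 0, (y, x) ∈ affineChart (0 : Fin (n + 2)) ⁻¹' S := by
    intro y hy
    -- With `ξ₀ = -a` the point satisfies `ξ · z = 0`; translation by `1 + a` then brings `ξ₀` to 1.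
    let a : ℂ := ∑ j, y j * z j
    have hne : (Fin.cons (-a) y : Fin (n + 2) → ℂ) ≠ 0 := by
      simpa using cons_ne_single hy (-a) 0
    have hmem : (Fin.cons (-a) y, x) ∈ homogCone S := by
      refine ⟨hne, h _ ⟨hx, ?_⟩⟩
      rw [pairing_rep_eq_zero_iff]
      simp [pairing, a]
    have h1 := hR _ _ (cons_ne_single hy (-a)) hmem (1 + a)
    rw [← affineLift_mem_homogCone_iff, affineLift_zero_eq]
    convert h1 using 2
    funext j
    refine Fin.cases ?_ (fun i => ?_) j <;> simp
  refine ⟨x, hx, fun y => ?_⟩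
  by_cases hy : y = 0
  · have h1 : (fun _ => 1 : Fin (n + 1) → ℂ) ≠ 0 := fun h => one_ne_zero (congrFun h 0)
    simpa [hy] using hR.smul_mem hS (key _ h1) 0
  · exact key y hy

/-- A ruled smooth hypersurface that contains a fibre of `P_z → X` is the preimage of a smooth
hypersurface in `X`. -/
theorem IsRuled.eq_preimage_vertexSlice (hR : IsRuled S) (hS : IsSmoothHypersurfaceInY X S)
    (hXo : IsOpen X) (hXc : IsConnected X) {z : Fin (n + 1) → ℂ} (hfib : ContainsFibreOfP X z S) :
    IsSmoothHypersurface X (vertexSlice S) ∧ S = {p : Ambient n | p.2 ∈ vertexSlice S} := by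
  have hempty : interior (vertexSlice S) = ∅ := by
    obtain ⟨x, hx, hfull⟩ := hR.exists_forall_mem hS hfib
    refine (hR.interior_vertexSlice hS hXc).resolve_right fun hSX => ?_
    have hxS : x ∈ vertexSlice S := hfull 0
    obtain ⟨s, hs⟩ := (hS.2 0).locallyDefined _ hxS
    have hint : x ∈ interior (vertexSlice S) := by rwa [hSX, hXo.interior_eq]
    have hr : (fderiv ℂ s (0, x)).comp (.inr ℂ _ _) = 0 := by
      by_contra h
      exact (hR.fderiv_comp_inr_ne_zero_iff hS hs hxS).1 h hint
    have ht : Tendsto (fun y : Fin (n + 1) → ℂ => (y, x)) (𝓝 0) (𝓝 (0, x)) :=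
      (Continuous.prodMk_left _).tendsto 0
    have hl : (fderiv ℂ s (0, x)).comp (.inl ℂ _ _) = 0 := by
      refine (hs.analyticAt.differentiableAt.hasFDerivAt.comp (0 : Fin (n + 1) → ℂ)
        (hasFDerivAt_prodMk_left 0 x)).unique
        ((hasFDerivAt_const (0 : ℂ) _).congr_of_eventuallyEq ?_)
      filter_upwards [ht.eventually hs.eventually_mem_iff] with y hy
      exact hy.1 (hfull y)
    refine hs.fderiv_ne_zero (ContinuousLinearMap.ext fun v => ?_)
    have h1 := congrArg (fun l : (Fin (n + 1) → ℂ) →L[ℂ] ℂ => l v.1) hl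
    have h2 := congrArg (fun l : (Fin (n + 1) → ℂ) →L[ℂ] ℂ => l v.2) hr
    have hv : v = (v.1, 0) + (0, v.2) := by simp
    rw [hv, map_add]
    simpa using congrArg₂ (· + ·) h1 h2
  have htrans : ∀ x ∈ vertexSlice S, ∀ s,
      IsLocalDefiningFunction (affineChart (0 : Fin (n + 2)) ⁻¹' S) s (0, x) →
      (fderiv ℂ s (0, x)).comp (.inr ℂ _ _) ≠ 0 := fun x hx s hs =>
    (hR.fderiv_comp_inr_ne_zero_iff hS hs hx).2 (by simp [hempty])
  refine ⟨⟨vertexSlice_subset hS, exists_isClosed_vertexSlice_eq hS, fun x hx => ?_⟩, ?_⟩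
  · obtain ⟨s, hs⟩ := (hS.2 0).locallyDefined _ hx
    have ht : Tendsto (fun x' : Fin (n + 1) → ℂ => ((0 : Fin (n + 1) → ℂ), x')) (𝓝 x)
      (𝓝 (0, x)) := (Continuous.prodMk_right _).tendsto x
    refine ⟨fun x' => s (0, x'), ⟨?_, ?_, ht.eventually hs.eventually_mem_iff⟩⟩
    · exact hs.analyticAt.comp (f := fun x' => ((0 : Fin (n + 1) → ℂ), x'))
        (analyticAt_const.prod analyticAt_id)
    · rw [(hasFDerivAt_inr_slice hs.analyticAt).fderiv]
      exact htrans x hx s hs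
  · ext ⟨l, x⟩
    have hl : (l, x) ∈ S ↔ (l.rep, x) ∈ homogCone S := by
      constructor
      · exact fun h => ⟨l.rep_nonzero, by simpa using h⟩
      · rintro ⟨h1, h2⟩
        simpa using h2
    rw [hl]
    refine ⟨fun h => mem_vertexSlice_of_mem hR hS h, fun hx => ?_⟩
    obtain ⟨s, hs⟩ := (hS.2 0).locallyDefined _ hx
    obtain ⟨w, hw⟩ : ∃ w, fderiv ℂ s (0, x) (0, w) ≠ 0 := by
      by_contra! H
      exact htrans x hx s hs (ContinuousLinearMap.ext fun w => by simpa using H w)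
    exact mem_homogCone_of_forall hR (hR.mem_of_fderiv_ne_zero hS hs hx hw) l.rep_nonzero

end Ruled

end Homogeneous

end CauchyFantappie

theorem mainTheorem4 (n : ℕ) (X : Set (Fin (n + 1) → ℂ)) (hXo : IsOpen X) (hXc : IsConnected X)
    (z : Fin (n + 1) → ℂ) (hz : z ∈ X) (S : Set (CauchyFantappie.Ambient n))
    (hS : CauchyFantappie.IsSmoothHypersurfaceInY X S)
    (hgen : CauchyFantappie.InGeneralPosition X
      ![CauchyFantappie.hypersurfaceP X z, CauchyFantappie.hypersurfaceQ X, S])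
    (hfib : CauchyFantappie.ContainsFibreOfP X z S)
    (hPhi : CauchyFantappie.PhiVanishesOn X z S) :
    ∃ S₀ : Set (Fin (n + 1) → ℂ), CauchyFantappie.IsSmoothHypersurface X S₀ ∧
      S = {p : CauchyFantappie.Ambient n | p.2 ∈ S₀} := by
  have hR : CauchyFantappie.IsRuled S := CauchyFantappie.isRuled_of_zerothDirection_mem hS
    fun _ _ hp => CauchyFantappie.zerothDirection_mem_tangentSpaceAt_of_inGeneralPosition hXo hS
      hgen hPhi hp
  exact ⟨_, hR.eq_preimage_vertexSlice hS hXo hXc hfib⟩
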